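/- Let $G$ be a compact Lie group with Lie algebra $\mathfrak{g}$, and let $h_t$, $t\in(-\varepsilon,\varepsilon)$ with $\varepsilon>0$, be a family of left-invariant Riemannian metrics on $G$ with $h_0$ bi-invariant. Write $\langle A,B\rangle=h_0(A,B)$ for $A,B\in\mathfrak{g}$, and let $\Phi_t:\mathfrak{g}\to\mathfrak{g}$ be the linear isomorphism determined by $h_t(A,B)=\langle\Phi_tA,B\rangle$ for all $A,B\in\mathfrak{g}$. Assume that $\Phi_t$ is inverse-linear, i.e. there is a linear map $\Psi:\mathfrak{g}\to\mathfrak{g}$ with $\Phi_t^{-1}=I-t\Psi$ for all $t\in(-\varepsilon,\varepsilon)$. Let $X,Y\in\mathfrak{g}$ with $[X,Y]=0$, and let $$\kappa(t)=h_t\big(R_t(\Phi_t^{-1}X,\Phi_t^{-1}Y)\Phi_t^{-1}Y,\ \Phi_t^{-1}X\big)$$ be the unnormalized sectional curvature of $\Phi_t^{-1}X$ and $\Phi_t^{-1}Y$ with respect to $h_t$, where $R_t(A,B)C=\nabla_A\nabla_BC-\nabla_B\nabla_AC-\nabla_{[A,B]}C$ is the curvature tensor of the Levi-Civita connection $\nabla$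 of $h_t$. Then $\kappa$ is three times continuously differentiable near $0$, $\kappa(0)=0$, $\kappa'(0)=0$, $\kappa''(0)=0$, and \begin{align*} \tfrac16\kappa'''(0)={}&\langle[X,\Psi Y]+[\Psi X,Y],[\Psi X,\Psi Y]\rangle+\langle[\Psi X,X],\Psi[\Psi Y,Y]\rangle\\ &-\langle[X,\Psi Y],\Psi[X,\Psi Y]\rangle-\langle[X,\Psi Y],\Psi[\Psi X,Y]\rangle-\langle[\Psi X,Y],\Psi[\Psi X,Y]\rangle . \end{align*} -/

import Mathlib

open Bundle VectorField Filter
open scoped Manifold ContDiff Topology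

noncomputable section

namespace LieGroupCurvature

/-! ### Riemannian metrics, the Levi-Civita connection and curvature -/

section Manifold

variable {E : Type*} [NormedAddCommGroup E] [NormedSpace ℝ E]
  {M : Type*} [TopologicalSpace M] [ChartedSpace E M]

/-- Smooth Riemannian metrics on a manifold `M` modelled on `E`; `g.inner x v w` is the inner
product of `v, w ∈ T_x M`. -/
abbrev Metric (E : Type*) [NormedAddCommGroup E] [NormedSpace ℝ E]
    (M : Type*) [TopologicalSpace M] [ChartedSpace E M] [IsManifold 𝓘(ℝ, E) ∞ M] : Type _ :=
  ContMDiffRiemannianMetric 𝓘(ℝ, E) ∞ E (TangentSpace 𝓘(ℝ, E) : M → Type _)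

/-- Affine connections on `M`. For `D : Connection E M` and vector fields `X`, `Y`, the value of
`∇_X Y` at `x` is `D Y x (X x)`. -/
abbrev Connection (E : Type*) [NormedAddCommGroup E] [NormedSpace ℝ E]
    (M : Type*) [TopologicalSpace M] [ChartedSpace E M] [IsManifold 𝓘(ℝ, E) ∞ M] : Type _ :=
  CovariantDerivative 𝓘(ℝ, E) E (TangentSpace 𝓘(ℝ, E) : M → Type _)

/-- `D` is the Levi-Civita connection of `g`: it is torsion-free, and it is compatible with `g`,
that is, `X (g(Y, Z)) = g(∇_X Y, Z) + g(Y, ∇_X Z)`. -/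
structure IsLeviCivita [FiniteDimensional ℝ E] [IsManifold 𝓘(ℝ, E) ∞ M]
    (g : Metric E M) (D : Connection E M) : Prop where
  torsion_eq_zero : D.torsion = 0
  compatible : ∀ (x : M) (v : TangentSpace 𝓘(ℝ, E) x)
    (Y Z : Π y : M, TangentSpace 𝓘(ℝ, E) y),
    MDifferentiableAt 𝓘(ℝ, E) 𝓘(ℝ, E).tangent
      (fun y => (TotalSpace.mk' E y (Y y) : TangentBundle 𝓘(ℝ, E) M)) x →
    MDifferentiableAt 𝓘(ℝ, E) 𝓘(ℝ, E).tangent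
      (fun y => (TotalSpace.mk' E y (Z y) : TangentBundle 𝓘(ℝ, E) M)) x →
    mfderiv 𝓘(ℝ, E) 𝓘(ℝ, ℝ) (fun y => g.inner y (Y y) (Z y)) x v
      = g.inner x (D Y x v) (Z x) + g.inner x (Y x) (D Z x v)

/-- The curvature `R(X, Y) Z = ∇_X ∇_Y Z - ∇_Y ∇_X Z - ∇_{[X, Y]} Z` at the point `x`. -/
def curvature [IsManifold 𝓘(ℝ, E) ∞ M] (D : Connection E M)
    (X Y Z : Π y : M, TangentSpace 𝓘(ℝ, E) y) (x : M) : TangentSpace 𝓘(ℝ, E) x :=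
  D (fun y => D Z y (Y y)) x (X x) - D (fun y => D Z y (X y)) x (Y x)
    - D Z x (mlieBracket 𝓘(ℝ, E) X Y x)

open scoped Classical in
/-- The unnormalized sectional curvature `g(R(X, Y) Y, X)` at `x` of smooth vector fields `X`, `Y`,
computed with the Levi-Civita connection of `g`. That connection exists and is unique on
differentiable vector fields, so the value `0` in the second branch is never taken. -/
def sectionalCurvature [FiniteDimensional ℝ E] [IsManifold 𝓘(ℝ, E) ∞ M]
    (g : Metric E M) (X Y : Π y : M, TangentSpace 𝓘(ℝ, E) y) (x : M) : ℝ :=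
  if hg : ∃ D : Connection E M, IsLeviCivita g D then
    g.inner x (curvature hg.choose X Y Y x) (X x)
  else 0

end Manifold

/-! ### Invariant metrics on Lie groups -/

section Group

variable {E : Type*} [NormedAddCommGroup E] [NormedSpace ℝ E]
  {G : Type*} [TopologicalSpace G] [ChartedSpace E G] [Group G] [LieGroup 𝓘(ℝ, E) ∞ G]

/-- All left translations are isometries of `g`. -/
def IsLeftInvariant (g : Metric E G) : Prop :=
  ∀ (a x : G) (v w : TangentSpace 𝓘(ℝ, E) x),
    g.inner (a * x) (mfderiv 𝓘(ℝ, E) 𝓘(ℝ, E) (fun y : G => a * y) x v)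
      (mfderiv 𝓘(ℝ, E) 𝓘(ℝ, E) (fun y : G => a * y) x w) = g.inner x v w

/-- All right translations are isometries of `g`. -/
def IsRightInvariant (g : Metric E G) : Prop :=
  ∀ (a x : G) (v w : TangentSpace 𝓘(ℝ, E) x),
    g.inner (x * a) (mfderiv 𝓘(ℝ, E) 𝓘(ℝ, E) (fun y : G => y * a) x v)
      (mfderiv 𝓘(ℝ, E) 𝓘(ℝ, E) (fun y : G => y * a) x w) = g.inner x v w

/-- A metric is bi-invariant if it is left- and right-invariant. -/
def IsBiInvariant (g : Metric E G) : Prop :=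
  IsLeftInvariant g ∧ IsRightInvariant g

/-- The unnormalized sectional curvature with respect to `g` of the elements `Z₁`, `Z₂` of the Lie
algebra of `G`, regarded as left-invariant vector fields, at the identity. -/
def lieSectionalCurvature [FiniteDimensional ℝ E] (g : Metric E G)
    (Z₁ Z₂ : GroupLieAlgebra 𝓘(ℝ, E) G) : ℝ :=
  sectionalCurvature g (mulInvariantVectorField Z₁) (mulInvariantVectorField Z₂) 1

end Group

end LieGroupCurvature

end

/-!
The Levi-Civita connection of a left-invariant metric restricts to a bilinear product on the Lie
algebra, given by the Koszul formula. If the metric is `⟨Φ a, b⟩` with `⟨ , ⟩` ad-invariant, then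
`2 ∇_x y = [x, y] + Φ⁻¹([x, Φ y] + [y, Φ x])`, and the curvature of `x = Φ⁻¹ X`, `y = Φ⁻¹ Y` becomes
a quadratic expression in the brackets `[X, y]`, `[x, Y]`, `[x, y]`, `[x, X]`, `[y, Y]`. Each of
these is divisible by `t` when `Φ⁻¹ = 1 - t Ψ` and `[X, Y] = 0`. With `p = [X, Ψ Y]` and
`q = [Ψ X, Y]`, the terms of order `t ^ 2` add up to `|p - q|² - |p + q|² - 4 ⟨[Ψ X, X], [Ψ Y, Y]⟩`,
which vanishes because `⟨[Ψ X, X], [Ψ Y, Y]⟩ = -⟨p, q⟩` by the Jacobi identity.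

A bi-invariant metric is ad-invariant because left-invariant fields commute with right-invariant
ones: by torsion-freeness, `[a, b]` is at the identity the difference of the derivatives in the
direction `a` of the left- and of the right-invariant field extending `b`, and both derivatives are
skew in `b` since inner products of such fields are constant.
-/

noncomputable section

namespace LieGroupCurvature

section LeviCivitaProduct

variable {K V : Type*} [Field K] [LieRing V] [LieAlgebra K V]

/-- The right-hand side `(B([a, b], c) - B([b, c], a) - B([a, c], b)) / 2` of the Koszul formula,
for the metric `B` and left-invariant vector fields. -/
def koszulForm (B : LinearMap.BilinForm K V) : V →ₗ[K] V →ₗ[K] V →ₗ[K] K :=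
  LinearMap.mk₂ K
    (fun a b => (2⁻¹ : K) • (B ⁅a, b⁆ - B.flip a ∘ₗ LieAlgebra.ad K V b
      - B.flip b ∘ₗ LieAlgebra.ad K V a))
    (fun a a' b => by ext; simp; ring) (fun r a b => by ext; simp; ring)
    (fun a b b' => by ext; simp; ring) (fun r a b => by ext; simp; ring)

variable [FiniteDimensional K V] {B : LinearMap.BilinForm K V}

/-- The product `∇_a b` on a Lie algebra which describes the Levi-Civita connection of the
left-invariant metric `B`; it is defined by the Koszul formula. -/
def leviCivitaProduct (B : LinearMap.BilinForm K V) (hB : B.Nondegenerate) : V →ₗ[K] V →ₗ[K] V :=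
  (koszulForm B).compr₂ (B.toDual hB).symm.toLinearMap

theorem form_leviCivitaProduct (hB : B.Nondegenerate) (a b c : V) :
    B (leviCivitaProduct B hB a b) c = 2⁻¹ * (B ⁅a, b⁆ c - B ⁅b, c⁆ a - B ⁅a, c⁆ b) :=
  LinearMap.BilinForm.apply_toDual_symm_apply (hB := hB) (koszulForm B a b) c

theorem eq_of_forall_form_eq (hB : B.Nondegenerate) {a b : V} (h : ∀ c, B a c = B b c) : a = b :=
  (B.toDual hB).injective (LinearMap.ext h)

theorem form_leviCivitaProduct_add_form_leviCivitaProduct (hB : B.Nondegenerate) (hs : B.IsSymm)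
    (a b c : V) :
    B (leviCivitaProduct B hB a b) c + B b (leviCivitaProduct B hB a c) = 0 := by
  rw [hs.eq b, form_leviCivitaProduct, form_leviCivitaProduct, ← lie_skew b c,
    map_neg, LinearMap.neg_apply]
  ring

variable (B) in
/-- The curvature `R(a, b) c = ∇_a ∇_b c - ∇_b ∇_a c - ∇_[a, b] c` of the left-invariant metric `B`
on the Lie algebra. -/
def leviCivitaCurvature (hB : B.Nondegenerate) (a b c : V) : V :=
  leviCivitaProduct B hB a (leviCivitaProduct B hB b c)
    - leviCivitaProduct B hB b (leviCivitaProduct B hB a c) - leviCivitaProduct B hB ⁅a, b⁆ c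

theorem form_leviCivitaCurvature (hB : B.Nondegenerate) (hs : B.IsSymm) (a b c d : V) :
    B (leviCivitaCurvature B hB a b c) d
      = B (leviCivitaProduct B hB a c) (leviCivitaProduct B hB b d)
        - B (leviCivitaProduct B hB b c) (leviCivitaProduct B hB a d)
        - B (leviCivitaProduct B hB ⁅a, b⁆ c) d := by
  have hskew := form_leviCivitaProduct_add_form_leviCivitaProduct hB hs
  rw [leviCivitaCurvature]
  simp only [map_sub, LinearMap.sub_apply]
  linear_combination hskew a (leviCivitaProduct B hB b c) d
    - hskew b (leviCivitaProduct B hB a c) d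

variable [NeZero (2 : K)]

theorem leviCivitaProduct_sub_leviCivitaProduct (hB : B.Nondegenerate) (a b : V) :
    leviCivitaProduct B hB a b - leviCivitaProduct B hB b a = ⁅a, b⁆ := by
  refine eq_of_forall_form_eq hB fun c => ?_
  rw [map_sub, LinearMap.sub_apply, form_leviCivitaProduct, form_leviCivitaProduct, ← lie_skew a b,
    map_neg, LinearMap.neg_apply]
  linear_combination -B ⁅b, a⁆ c * inv_mul_cancel₀ (two_ne_zero (α := K))

theorem eq_leviCivitaProduct (hB : B.Nondegenerate) (hs : B.IsSymm) {N : V → V → V}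
    (htorsion : ∀ a b, N a b - N b a = ⁅a, b⁆) (hskew : ∀ a b c, B (N a b) c + B b (N a c) = 0)
    (a b : V) : N a b = leviCivitaProduct B hB a b := by
  refine eq_of_forall_form_eq hB fun c => ?_
  have hswap (a b c : V) : B (N a b) c - B (N b a) c = B ⁅a, b⁆ c := by
    rw [← htorsion, map_sub, LinearMap.sub_apply]
  have hskew' (a b c : V) : B (N a b) c + B (N a c) b = 0 := by rw [hs.eq (N a c), hskew]
  rw [form_leviCivitaProduct, ← hswap a b, ← hswap b c, ← hswap a c]
  linear_combination -B (N a b) c * inv_mul_cancel₀ (two_ne_zero (α := K))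
    + 2⁻¹ * (hskew' a b c + hskew' b a c - hskew' c a b)

end LeviCivitaProduct

section Puttmann

variable {K V : Type*} [Field K] [LieRing V] [LieAlgebra K V]
  {B C : LinearMap.BilinForm K V} {Φ : V ≃ₗ[K] V}

/-- The coefficient of `t ^ 3` in the expansion of the unnormalized sectional curvature along an
inverse-linear path of left-invariant metrics with derivative `Ψ` at a bi-invariant metric `B`. -/
def cubicCoefficient (B : LinearMap.BilinForm K V) (Ψ : V →ₗ[K] V) (X Y : V) : K :=
  B (⁅X, Ψ Y⁆ + ⁅Ψ X, Y⁆) ⁅Ψ X, Ψ Y⁆ + B ⁅Ψ X, X⁆ (Ψ ⁅Ψ Y, Y⁆) - B ⁅X, Ψ Y⁆ (Ψ ⁅X, Ψ Y⁆)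
    - B ⁅X, Ψ Y⁆ (Ψ ⁅Ψ X, Y⁆) - B ⁅Ψ X, Y⁆ (Ψ ⁅Ψ X, Y⁆)

/-- The remainder of the expansion of the unnormalized sectional curvature beyond the cubic term,
divided by `-3 t ^ 4 / 4`; here `Φ = (1 - t Ψ)⁻¹`. -/
def quarticRemainder (B : LinearMap.BilinForm K V) (Ψ : V →ₗ[K] V) (X Y : V) (t : K)
    (Φ : V →ₗ[K] V) : K :=
  B ⁅Ψ X, Ψ Y⁆ ⁅Ψ X, Ψ Y⁆ - 2 * B (Ψ (⁅X, Ψ Y⁆ + ⁅Ψ X, Y⁆)) ⁅Ψ X, Ψ Y⁆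
    + t * B (Ψ ⁅Ψ X, Ψ Y⁆) ⁅Ψ X, Ψ Y⁆
    + B (Φ (Ψ (Ψ (⁅X, Ψ Y⁆ + ⁅Ψ X, Y⁆ - t • ⁅Ψ X, Ψ Y⁆))))
      (⁅X, Ψ Y⁆ + ⁅Ψ X, Y⁆ - t • ⁅Ψ X, Ψ Y⁆)

theorem form_lie_lie_eq_neg (hB : B.lieInvariant V) {X Y : V} (hXY : ⁅X, Y⁆ = 0) (a b : V) :
    B ⁅a, X⁆ ⁅b, Y⁆ = -B ⁅a, Y⁆ ⁅X, b⁆ := by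
  have hJacobi : ⁅X, ⁅b, Y⁆⁆ = -⁅Y, ⁅X, b⁆⁆ := by
    rw [leibniz_lie, hXY, lie_zero, add_zero, lie_skew]
  rw [← lie_skew a X, ← lie_skew a Y, map_neg, map_neg, LinearMap.neg_apply, LinearMap.neg_apply,
    hB, hB, hJacobi, map_neg]

theorem form_apply_self_of_symm_eq (hBs : B.IsSymm) {Ψ : V →ₗ[K] V} {t : K}
    (hΨ : ∀ a, Φ.symm a = a - t • Ψ a) (m : V) :
    B (Φ m) m = B m m + t * B m (Ψ m) + t ^ 2 * B (Φ (Ψ (Ψ m))) m := by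
  have hΦm (a : V) : Φ a = a + t • Φ (Ψ a) := by
    have h := congrArg Φ (hΨ a)
    rw [Φ.apply_symm_apply, map_sub, map_smul] at h
    exact (eq_add_of_sub_eq' h.symm).trans (add_comm _ _)
  rw [hΦm m, hΦm (Ψ m), hBs.eq m (Ψ m)]
  simp only [map_add, map_smul, LinearMap.add_apply, LinearMap.smul_apply, smul_eq_mul]
  ring

theorem form_apply_comm_of_symm_eq (hBs : B.IsSymm) (hCs : C.IsSymm)
    (hΦ : ∀ a b, C a b = B (Φ a) b) {Ψ : V →ₗ[K] V} {t : K} (ht : t ≠ 0)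
    (hΨ : ∀ a, Φ.symm a = a - t • Ψ a) (a b : V) : B (Ψ a) b = B a (Ψ b) := by
  have hcomm : B b (Φ.symm a) = B a (Φ.symm b) := by
    simpa only [hΦ, LinearEquiv.apply_symm_apply] using hCs.eq (Φ.symm b) (Φ.symm a)
  rw [hΨ, hΨ, map_sub, map_sub, map_smul, map_smul, hBs.eq b a, sub_right_inj, smul_right_inj ht,
    hBs.eq b] at hcomm
  exact hcomm

variable [FiniteDimensional K V]

theorem leviCivitaProduct_eq_of_lieInvariant (hC : C.Nondegenerate) (hCs : C.IsSymm)
    (hB : B.lieInvariant V) (hΦ : ∀ a b, C a b = B (Φ a) b) (x y : V) :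
    leviCivitaProduct C hC x y = (2⁻¹ : K) • (⁅x, y⁆ + Φ.symm (⁅x, Φ y⁆ + ⁅y, Φ x⁆)) := by
  refine eq_of_forall_form_eq hC fun c => ?_
  have hinv (x y c : V) : C ⁅y, c⁆ x = -B ⁅y, Φ x⁆ c := by rw [hCs.eq, hΦ, hB, neg_neg]
  rw [form_leviCivitaProduct, hinv x y c, hinv y x c]
  simp only [map_smul, map_add, LinearMap.smul_apply, LinearMap.add_apply, hΦ _ c,
    LinearEquiv.apply_symm_apply, smul_eq_mul]
  ring

variable [NeZero (2 : K)]

theorem leviCivitaProduct_self_of_lieInvariant (hC : C.Nondegenerate) (hCs : C.IsSymm)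
    (hB : B.lieInvariant V) (hΦ : ∀ a b, C a b = B (Φ a) b) (x : V) :
    leviCivitaProduct C hC x x = Φ.symm ⁅x, Φ x⁆ := by
  rw [leviCivitaProduct_eq_of_lieInvariant hC hCs hB hΦ, lie_self, zero_add, ← two_smul K,
    map_smul, smul_smul, inv_mul_cancel₀ two_ne_zero, one_smul]

/-- Püttmann's curvature formula. -/
theorem four_mul_form_leviCivitaCurvature (hC : C.Nondegenerate) (hCs : C.IsSymm)
    (hB : B.lieInvariant V) (hΦ : ∀ a b, C a b = B (Φ a) b) (x y : V) :
    4 * C (leviCivitaCurvature C hC x y y) x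
      = 2 * B (⁅Φ x, y⁆ + ⁅x, Φ y⁆) ⁅x, y⁆ - 3 * B (Φ ⁅x, y⁆) ⁅x, y⁆
        + B (⁅x, Φ y⁆ + ⁅y, Φ x⁆) (Φ.symm (⁅x, Φ y⁆ + ⁅y, Φ x⁆))
        - 4 * B ⁅x, Φ x⁆ (Φ.symm ⁅y, Φ y⁆) := by
  have hhalf : (2 * 2⁻¹ : K) = 1 := mul_inv_cancel₀ two_ne_zero
  have hΦs (a b : V) : C (Φ.symm a) b = B a b := by rw [hΦ, Φ.apply_symm_apply]
  have hmixed : 4 * C (leviCivitaProduct C hC x y) (leviCivitaProduct C hC y x)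
      = B (⁅x, Φ y⁆ + ⁅y, Φ x⁆) (Φ.symm (⁅x, Φ y⁆ + ⁅y, Φ x⁆)) - B (Φ ⁅x, y⁆) ⁅x, y⁆ := by
    rw [leviCivitaProduct_eq_of_lieInvariant hC hCs hB hΦ x,
      leviCivitaProduct_eq_of_lieInvariant hC hCs hB hΦ y, add_comm ⁅y, Φ x⁆, ← lie_skew x y,
      ← hΦs, ← hΦ]
    generalize Φ.symm (⁅x, Φ y⁆ + ⁅y, Φ x⁆) = w
    generalize ⁅y, x⁆ = z
    simp only [map_smul, map_add, map_neg, LinearMap.smul_apply, LinearMap.add_apply,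
      LinearMap.neg_apply, smul_eq_mul]
    linear_combination (2 * 2⁻¹ + 1) * (C w w - C z z) * hhalf + (2 * 2⁻¹) ^ 2 * hCs.eq w z
  have hbracket : 2 * C (leviCivitaProduct C hC ⁅x, y⁆ y) x
      = B (Φ ⁅x, y⁆) ⁅x, y⁆ - B (⁅Φ x, y⁆ + ⁅x, Φ y⁆) ⁅x, y⁆ := by
    have hinv (a b : V) : C ⁅⁅x, y⁆, a⁆ b = B ⁅a, Φ b⁆ ⁅x, y⁆ := by
      rw [← lie_skew, map_neg, LinearMap.neg_apply, hCs.eq, hΦ, hB]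
    rw [form_leviCivitaProduct, hinv, hinv, ← lie_skew x y, ← lie_skew (Φ x) y, ← hΦ]
    simp only [map_neg, map_add, LinearMap.add_apply, LinearMap.neg_apply]
    linear_combination (C ⁅y, x⁆ ⁅y, x⁆ - B ⁅y, Φ x⁆ ⁅y, x⁆ + B ⁅x, Φ y⁆ ⁅y, x⁆) * hhalf
  rw [form_leviCivitaCurvature hC hCs, leviCivitaProduct_self_of_lieInvariant hC hCs hB hΦ,
    leviCivitaProduct_self_of_lieInvariant hC hCs hB hΦ, hCs.eq (Φ.symm _), hΦs]
  linear_combination hmixed - 2 * hbracket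

theorem four_mul_form_leviCivitaCurvature_of_symm_eq (hC : C.Nondegenerate) (hCs : C.IsSymm)
    (hB : B.lieInvariant V) (hBs : B.IsSymm) (hΦ : ∀ a b, C a b = B (Φ a) b) {Ψ : V →ₗ[K] V}
    (hΨs : ∀ a b, B (Ψ a) b = B a (Ψ b)) {t : K} (hΨ : ∀ a, Φ.symm a = a - t • Ψ a) {X Y : V}
    (hXY : ⁅X, Y⁆ = 0) :
    4 * C (leviCivitaCurvature C hC (Φ.symm X) (Φ.symm Y) (Φ.symm Y)) (Φ.symm X)
      = t ^ 3 * (4 * cubicCoefficient B Ψ X Y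
        - 3 * t * quarticRemainder B Ψ X Y t Φ.toLinearMap) := by
  have hflat := form_lie_lie_eq_neg hB hXY (Ψ X) (Ψ Y)
  have hXy : ⁅X, Φ.symm Y⁆ = -t • ⁅X, Ψ Y⁆ := by simp [hΨ, hXY]
  have hxY : ⁅Φ.symm X, Y⁆ = -t • ⁅Ψ X, Y⁆ := by simp [hΨ, hXY]
  have hyX : ⁅Φ.symm Y, X⁆ = t • ⁅X, Ψ Y⁆ := by rw [← lie_skew, hXy, neg_smul, neg_neg]
  have hxX : ⁅Φ.symm X, X⁆ = -t • ⁅Ψ X, X⁆ := by simp [hΨ]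
  have hyY : ⁅Φ.symm Y, Y⁆ = -t • ⁅Ψ Y, Y⁆ := by simp [hΨ]
  have hxy : ⁅Φ.symm X, Φ.symm Y⁆ = -t • (⁅X, Ψ Y⁆ + ⁅Ψ X, Y⁆ - t • ⁅Ψ X, Ψ Y⁆) := by
    simp only [hΨ, sub_lie, lie_sub, smul_lie, lie_smul, hXY]
    module
  rw [four_mul_form_leviCivitaCurvature hC hCs hB hΦ, Φ.apply_symm_apply, Φ.apply_symm_apply,
    hXy, hxY, hyX, hxX, hyY, hxy]
  simp only [map_smul, LinearMap.smul_apply, smul_eq_mul]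
  rw [form_apply_self_of_symm_eq hBs hΨ, cubicCoefficient, quarticRemainder, LinearEquiv.coe_coe]
  generalize B (Φ (Ψ (Ψ _))) _ = r
  generalize ⁅X, Ψ Y⁆ = p at *
  generalize ⁅Ψ X, Y⁆ = q at *
  generalize ⁅Ψ X, Ψ Y⁆ = w at *
  generalize ⁅Ψ X, X⁆ = a at *
  generalize ⁅Ψ Y, Y⁆ = b at *
  simp only [hΨ, map_add, map_sub, map_smul, LinearMap.add_apply, LinearMap.sub_apply,
    LinearMap.smul_apply, smul_eq_mul, hΨs]
  have hcomm (a b : V) : B a (Ψ b) = B b (Ψ a) := by rw [← hΨs, hBs.eq]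
  rw [hflat, hcomm a b, hBs.eq p q, hBs.eq p w, hBs.eq q w, hcomm p q, hcomm p w, hcomm q w]
  ring

end Puttmann

section Calculus

variable {𝕜 : Type*} [NontriviallyNormedField 𝕜]

theorem iteratedDeriv_pow_mul_zero {s : 𝕜 → 𝕜} {k n : ℕ} (hs : ContDiffAt 𝕜 n s 0) (hkn : k ≤ n) :
    iteratedDeriv k (fun t => t ^ n * s t) 0 = if k = n then (n.factorial : 𝕜) * s 0 else 0 := by
  rw [iteratedDeriv_fun_mul (contDiff_fun_id.pow n).contDiffAt (hs.of_le (by exact_mod_cast hkn))]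
  simp only [iteratedDeriv_fun_pow_zero]
  rw [Finset.sum_range_succ, Finset.sum_eq_zero fun i hi => by
    rw [if_neg ((Finset.mem_range.1 hi).trans_le hkn).ne]; simp]
  split_ifs with h
  · simp [h]
  · simp

theorem contDiffAt_of_sub_smul_eq {V : Type*} [NormedAddCommGroup V] [NormedSpace 𝕜 V]
    [CompleteSpace V] {T : V →L[𝕜] V} {φ : 𝕜 → V} {a : V}
    (hφ : ∀ᶠ t in 𝓝 0, φ t - t • T (φ t) = a) (n : ℕ∞ω) : ContDiffAt 𝕜 n φ 0 := by
  have hpath : ContDiff 𝕜 n fun t : 𝕜 => 1 - t • T := by fun_prop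
  have hunit : ∀ᶠ t in 𝓝 (0 : 𝕜), IsUnit (1 - t • T) :=
    hpath.continuous.continuousAt.eventually_mem (Units.isOpen.mem_nhds (by simp))
  have hinverse : ContDiffAt 𝕜 n Ring.inverse (1 - (0 : 𝕜) • T) := by
    simpa using contDiffAt_ringInverse 𝕜 (n := n) (1 : (V →L[𝕜] V)ˣ)
  refine ((hinverse.comp 0 hpath.contDiffAt).clm_apply (contDiffAt_const (c := a)))
    |>.congr_of_eventuallyEq ?_
  filter_upwards [hφ, hunit] with t ht hu
  calc φ t = (Ring.inverse (1 - t • T) * (1 - t • T)) (φ t) := by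
        rw [Ring.inverse_mul_cancel _ hu, one_apply_eq_self]
    _ = Ring.inverse (1 - t • T) a := by rw [← ht]; rfl

theorem contDiffAt_form_apply_of_symm_eq [CompleteSpace 𝕜] {V : Type*} [NormedAddCommGroup V]
    [NormedSpace 𝕜 V] [FiniteDimensional 𝕜 V] {Φ : 𝕜 → V ≃ₗ[𝕜] V} {Ψ : V →ₗ[𝕜] V}
    (hΨ : ∀ᶠ t in 𝓝 0, ∀ a, (Φ t).symm a = a - t • Ψ a) (f : V →ₗ[𝕜] 𝕜) (a : V) (n : ℕ∞ω) :
    ContDiffAt 𝕜 n (fun t => f (Φ t a)) 0 := by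
  have : CompleteSpace V := FiniteDimensional.complete 𝕜 V
  have hΦ : ContDiffAt 𝕜 n (fun t => Φ t a) 0 :=
    contDiffAt_of_sub_smul_eq (T := LinearMap.toContinuousLinearMap Ψ) (a := a)
      (hΨ.mono fun t ht => by
        rw [LinearMap.coe_toContinuousLinearMap', ← ht, LinearEquiv.symm_apply_apply]) n
  exact (LinearMap.toContinuousLinearMap f).contDiff.contDiffAt.comp 0 hΦ

end Calculus

section LeftInvariant

variable {E : Type*} [NormedAddCommGroup E] [NormedSpace ℝ E]

theorem finiteDimensional_tangentSpace [FiniteDimensional ℝ E]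
    {M : Type*} [TopologicalSpace M] [ChartedSpace E M] (y : M) :
    FiniteDimensional ℝ (TangentSpace 𝓘(ℝ, E) y) :=
  inferInstanceAs (FiniteDimensional ℝ E)

theorem mfderiv_apply_of_eq_id {M : Type*} [TopologicalSpace M] [ChartedSpace E M] {f : M → M}
    (hf : f = id) (x : M) (v : E) : (mfderiv 𝓘(ℝ, E) 𝓘(ℝ, E) f x : E → E) v = v := by
  rw [hf, mfderiv_id]
  rfl

variable {G : Type*} [TopologicalSpace G] [ChartedSpace E G] [Group G]

theorem mulInvariantVectorField_one (a : GroupLieAlgebra 𝓘(ℝ, E) G) :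
    mulInvariantVectorField a (1 : G) = a :=
  mfderiv_apply_of_eq_id (E := E) (funext one_mul) 1 a

variable [LieGroup 𝓘(ℝ, E) ∞ G]

theorem mdifferentiableAt_mul_left (y x : G) :
    MDifferentiableAt 𝓘(ℝ, E) 𝓘(ℝ, E) (fun z : G => y * z) x :=
  (contMDiff_mul_left (n := ∞)).mdifferentiable (by simp) x

theorem mfderiv_mul_left_mfderiv_mul_left {y z p q : G} (hyz : y * z = 1) (hpq : p = z * q)
    (v : E) :
    (mfderiv 𝓘(ℝ, E) 𝓘(ℝ, E) (fun x : G => y * x) p : E → E)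
      ((mfderiv 𝓘(ℝ, E) 𝓘(ℝ, E) (fun x : G => z * x) q : E → E) v) = v := by
  subst hpq
  have hcomp : (fun x : G => y * x) ∘ (fun x : G => z * x) = id := by
    ext x
    rw [Function.comp_apply, ← mul_assoc, hyz, one_mul, id]
  have hchain := mfderiv_comp q (mdifferentiableAt_mul_left (E := E) y (z * q))
    (mdifferentiableAt_mul_left z q)
  refine Eq.trans ?_ (mfderiv_apply_of_eq_id hcomp q v)
  rw [hchain]
  rfl

/-- The Maurer–Cartan form of a Lie group at `y`: it takes a tangent vector to its left translate
at the identity. -/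
def maurerCartan (y : G) : TangentSpace 𝓘(ℝ, E) y ≃L[ℝ] GroupLieAlgebra 𝓘(ℝ, E) G :=
  ContinuousLinearEquiv.equivOfInverse (M₁ := E) (M₂ := E)
    (mfderiv 𝓘(ℝ, E) 𝓘(ℝ, E) (fun x : G => y⁻¹ * x) y)
    (mfderiv 𝓘(ℝ, E) 𝓘(ℝ, E) (fun x : G => y * x) 1)
    (mfderiv_mul_left_mfderiv_mul_left (mul_inv_cancel y) (inv_mul_cancel y).symm)
    (mfderiv_mul_left_mfderiv_mul_left (inv_mul_cancel y) (mul_one y).symm)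

theorem maurerCartan_symm_apply (y : G) (a : GroupLieAlgebra 𝓘(ℝ, E) G) :
    (maurerCartan y).symm a = mulInvariantVectorField a y := rfl

theorem maurerCartan_mulInvariantVectorField (a : GroupLieAlgebra 𝓘(ℝ, E) G) (y : G) :
    maurerCartan y (mulInvariantVectorField a y) = a :=
  (maurerCartan y).apply_symm_apply a

theorem mulInvariantVectorField_maurerCartan (y : G) (v : TangentSpace 𝓘(ℝ, E) y) :
    mulInvariantVectorField (maurerCartan y v) y = v :=
  (maurerCartan y).symm_apply_apply v

theorem mdiffAt_mfderiv_mul {p q : G → TangentBundle 𝓘(ℝ, E) G} {x : G}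
    (hp : MDiffAt p x) (hq : MDiffAt q x) :
    MDifferentiableAt 𝓘(ℝ, E) 𝓘(ℝ, E).tangent (fun y => (TotalSpace.mk' E ((p y).1 * (q y).1)
      (mfderiv 𝓘(ℝ, E) 𝓘(ℝ, E) (fun z : G => z * (q y).1) (p y).1 (p y).2
        + mfderiv 𝓘(ℝ, E) 𝓘(ℝ, E) (fun z : G => (p y).1 * z) (q y).1 (q y).2 : E) :
      TangentBundle 𝓘(ℝ, E) G)) x := by
  have hmul : CMDiff 1 (tangentMap% (fun r : G × G => r.1 * r.2)) :=
    (contMDiff_mul 𝓘(ℝ, E) ∞).contMDiff_tangentMap (m := 1) (by norm_cast)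
  have hprod : CMDiff 1 (equivTangentBundleProd 𝓘(ℝ, E) G 𝓘(ℝ, E) G).symm :=
    contMDiff_equivTangentBundleProd_symm
  have hcomp := (((hmul.comp hprod).mdifferentiable one_ne_zero) (p x, q x)).comp x (hp.prodMk hq)
  refine hcomp.congr_of_eventuallyEq (.of_forall fun y => ?_)
  have hadd := mfderiv_prod_eq_add_apply (p := ((p y).1, (q y).1))
    (v := ((show E from (p y).2), (show E from (q y).2)))
    ((contMDiff_mul 𝓘(ℝ, E) ∞).mdifferentiable (by simp)).mdifferentiableAt
  exact congrArg (TotalSpace.mk' E _) hadd.symm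

theorem snd_trivializationAt_mk {M : Type*} [TopologicalSpace M] [ChartedSpace E M]
    [IsManifold 𝓘(ℝ, E) ∞ M] {p q : M} (hpq : p = q) (v : E) :
    (trivializationAt E (TangentSpace 𝓘(ℝ, E)) q
      (TotalSpace.mk' E p (show TangentSpace 𝓘(ℝ, E) p from v))).2 = v := by
  subst hpq
  exact (tangentBundleCore 𝓘(ℝ, E) M).coordChange_self (achart E p) p (mem_chart_source E p) v

theorem mdiffAt_maurerCartan {Y : Π y : G, TangentSpace 𝓘(ℝ, E) y} {x : G}
    (hY : MDiffAt (T% Y) x) :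
    MDifferentiableAt (M' := E) 𝓘(ℝ, E) 𝓘(ℝ, E) (fun y => maurerCartan y (Y y)) x := by
  have hzero : MDiffAt (fun y : G => (TotalSpace.mk' E y⁻¹ 0 : TangentBundle 𝓘(ℝ, E) G)) x :=
    ((contMDiff_zeroSection ℝ (TangentSpace 𝓘(ℝ, E)) (n := ∞)).comp
      (contMDiff_inv 𝓘(ℝ, E) ∞)).mdifferentiable (by simp) x
  have hmul := mdiffAt_mfderiv_mul hzero hY
  refine ((mdifferentiableAt_totalSpace _ _).1 hmul).2.congr_of_eventuallyEq
    (.of_forall fun y => ?_)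
  refine Eq.trans ?_ (snd_trivializationAt_mk (by simp) _).symm
  exact ((congrArg (· + _) (map_zero (mfderiv 𝓘(ℝ, E) 𝓘(ℝ, E) (fun z : G => z * y) y⁻¹))).trans
    (zero_add _)).symm

/-- The right-invariant vector field associated to a vector `v` in the Lie algebra. -/
def rightInvariantVectorField (v : GroupLieAlgebra 𝓘(ℝ, E) G) (y : G) : TangentSpace 𝓘(ℝ, E) y :=
  mfderiv 𝓘(ℝ, E) 𝓘(ℝ, E) (fun x : G => x * y) (1 : G) v

theorem mdiffAt_rightInvariantVectorField (v : GroupLieAlgebra 𝓘(ℝ, E) G) (x : G) :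
    MDiffAt (T% (rightInvariantVectorField v : Π y : G, TangentSpace 𝓘(ℝ, E) y)) x := by
  have hzero : MDiffAt (fun y : G => (TotalSpace.mk' E y 0 : TangentBundle 𝓘(ℝ, E) G)) x :=
    (contMDiff_zeroSection ℝ (TangentSpace 𝓘(ℝ, E)) (n := 1)).mdifferentiable (by simp) x
  have hmul := mdiffAt_mfderiv_mul (mdifferentiableAt_const (c := TotalSpace.mk' E (1 : G) v)) hzero
  refine hmul.congr_of_eventuallyEq (.of_forall fun y => ?_)
  refine TotalSpace.ext (one_mul y).symm (heq_of_eq ?_)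
  exact ((congrArg (_ + ·) (map_zero (mfderiv 𝓘(ℝ, E) 𝓘(ℝ, E) (fun z : G => 1 * z) y))).trans
    (add_zero _)).symm

end LeftInvariant

section InvariantConnection

variable {E : Type*} [NormedAddCommGroup E] [NormedSpace ℝ E]

theorem t2Space_tangentSpace {M : Type*} [TopologicalSpace M] [ChartedSpace E M] (y : M) :
    T2Space (TangentSpace 𝓘(ℝ, E) y) :=
  inferInstanceAs (T2Space E)

variable {G : Type*} [TopologicalSpace G] [ChartedSpace E G] [Group G]
  [LieGroup 𝓘(ℝ, E) ∞ G]

/-- The derivative of a vector field, read in the trivialization of the tangent bundle of a Lie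
group by the Maurer–Cartan form. -/
def maurerCartanDeriv (Y : Π y : G, TangentSpace 𝓘(ℝ, E) y) (x : G) :
    TangentSpace 𝓘(ℝ, E) x →L[ℝ] GroupLieAlgebra 𝓘(ℝ, E) G :=
  mvfderiv (F := E) 𝓘(ℝ, E) (fun y => maurerCartan y (Y y)) x

theorem maurerCartanDeriv_add {Y Z : Π y : G, TangentSpace 𝓘(ℝ, E) y} {x : G}
    (hY : MDiffAt (T% Y) x) (hZ : MDiffAt (T% Z) x) :
    maurerCartanDeriv (Y + Z) x = maurerCartanDeriv Y x + maurerCartanDeriv Z x := by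
  have hadd : (fun y => (maurerCartan y ((Y + Z) y) : E))
      = (fun y => (maurerCartan y (Y y) : E)) + fun y => (maurerCartan y (Z y) : E) :=
    funext fun y => map_add (maurerCartan y) (Y y) (Z y)
  rw [maurerCartanDeriv, hadd]
  exact mvfderiv_add (mdiffAt_maurerCartan hY) (mdiffAt_maurerCartan hZ)

theorem maurerCartanDeriv_smul {f : G → ℝ} {Y : Π y : G, TangentSpace 𝓘(ℝ, E) y} {x : G}
    (hf : MDiffAt f x) (hY : MDiffAt (T% Y) x) :
    maurerCartanDeriv (f • Y) x = f x • maurerCartanDeriv Y x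
      + (mvfderiv 𝓘(ℝ, E) f x).smulRight (maurerCartan x (Y x)) := by
  have hsmul : (fun y => (maurerCartan y ((f • Y) y) : E))
      = f • fun y => (maurerCartan y (Y y) : E) :=
    funext fun y => map_smul (maurerCartan y) (f y) (Y y)
  rw [maurerCartanDeriv, hsmul]
  exact mvfderiv_smul hf (mdiffAt_maurerCartan hY)

theorem maurerCartanDeriv_mulInvariantVectorField (a : GroupLieAlgebra 𝓘(ℝ, E) G) (x : G) :
    maurerCartanDeriv (mulInvariantVectorField a) x = 0 := by
  have hconst : (fun y : G => (maurerCartan y (mulInvariantVectorField a y) : E)) = fun _ => a :=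
    funext (maurerCartan_mulInvariantVectorField a)
  rw [maurerCartanDeriv, hconst]
  exact mvfderiv_const _

attribute [local instance] finiteDimensional_tangentSpace t2Space_tangentSpace

variable [FiniteDimensional ℝ E]

/-- The connection on a Lie group whose restriction to left-invariant vector fields is given by
the bilinear product `N` on the Lie algebra: in the trivialization of the tangent bundle by the
Maurer–Cartan form, it is `d + N`. -/
def invariantConnection (N : GroupLieAlgebra 𝓘(ℝ, E) G →ₗ[ℝ] GroupLieAlgebra 𝓘(ℝ, E) G →ₗ[ℝ]
    GroupLieAlgebra 𝓘(ℝ, E) G) : Connection E G where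
  toFun Y x :=
    (maurerCartan x).symm.toContinuousLinearMap ∘L (maurerCartanDeriv Y x
      + (N.flip (maurerCartan x (Y x))).toContinuousLinearMap ∘L
        (maurerCartan x).toContinuousLinearMap)
  isCovariantDerivativeOnUniv :=
    { add := fun {σ σ' x} hσ hσ' _ => by
        rw [maurerCartanDeriv_add hσ hσ', ← ContinuousLinearMap.comp_add]
        congr 1
        ext v
        simp only [Pi.add_apply, map_add, _root_.add_apply, ContinuousLinearMap.comp_apply]
        abel
      leibniz := fun {σ f x} hσ hf _ => by
        rw [maurerCartanDeriv_smul hf hσ]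
        ext v
        simp only [Pi.smul_apply', map_add, map_smul, _root_.add_apply, _root_.smul_apply,
          ContinuousLinearMap.comp_apply, ContinuousLinearMap.smulRight_apply,
          ContinuousLinearEquiv.coe_coe, ContinuousLinearEquiv.symm_apply_apply]
        module }

theorem invariantConnection_mulInvariantVectorField
    (N : GroupLieAlgebra 𝓘(ℝ, E) G →ₗ[ℝ] GroupLieAlgebra 𝓘(ℝ, E) G →ₗ[ℝ]
      GroupLieAlgebra 𝓘(ℝ, E) G) (a c : GroupLieAlgebra 𝓘(ℝ, E) G) (x : G) :
    invariantConnection N (mulInvariantVectorField c) x (mulInvariantVectorField a x)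
      = mulInvariantVectorField (N a c) x := by
  change mulInvariantVectorField (maurerCartanDeriv (mulInvariantVectorField c) x _
    + N (maurerCartan x (mulInvariantVectorField a x))
      (maurerCartan x (mulInvariantVectorField c x))) x = _
  rw [maurerCartanDeriv_mulInvariantVectorField, maurerCartan_mulInvariantVectorField,
    maurerCartan_mulInvariantVectorField, _root_.zero_apply, zero_add]

end InvariantConnection

section LeviCivita

variable {E : Type*} [NormedAddCommGroup E] [NormedSpace ℝ E]
  {M : Type*} [TopologicalSpace M] [ChartedSpace E M] [IsManifold 𝓘(ℝ, E) ∞ M]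

theorem inner_congr_point (g : Metric E M) {y z : M} (h : z = y) (v w : E) :
    g.inner z (show TangentSpace 𝓘(ℝ, E) z from v) (show TangentSpace 𝓘(ℝ, E) z from w)
      = g.inner y (show TangentSpace 𝓘(ℝ, E) y from v) (show TangentSpace 𝓘(ℝ, E) y from w) := by
  subst h
  rfl

variable [FiniteDimensional ℝ E]

theorem IsLeviCivita.sub_eq_mlieBracket {g : Metric E M} {D : Connection E M}
    (hD : IsLeviCivita g D) {X Y : Π y : M, TangentSpace 𝓘(ℝ, E) y} {x : M}
    (hX : MDiffAt (T% X) x) (hY : MDiffAt (T% Y) x) :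
    D Y x (X x) - D X x (Y x) = mlieBracket 𝓘(ℝ, E) X Y x :=
  D.torsion_eq_zero_iff.1 hD.torsion_eq_zero hX hY

theorem IsLeviCivita.inner_add_inner_eq_zero {g : Metric E M} {D : Connection E M}
    (hD : IsLeviCivita g D) {x : M} (v : TangentSpace 𝓘(ℝ, E) x)
    {Y Z : Π y : M, TangentSpace 𝓘(ℝ, E) y} (hY : MDiffAt (T% Y) x) (hZ : MDiffAt (T% Z) x)
    {c : ℝ} (hc : ∀ y, g.inner y (Y y) (Z y) = c) :
    g.inner x (D Y x v) (Z x) + g.inner x (Y x) (D Z x v) = 0 := by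
  rw [← hD.compatible x v Y Z hY hZ, funext hc, mfderiv_const]
  rfl

end LeviCivita

section LeftInvariantMetric

variable {E : Type*} [NormedAddCommGroup E] [NormedSpace ℝ E]
  {G : Type*} [TopologicalSpace G] [ChartedSpace E G] [Group G] [LieGroup 𝓘(ℝ, E) ∞ G]

theorem lieGroup_minSmoothness : LieGroup 𝓘(ℝ, E) (minSmoothness ℝ 3) G := by
  rw [minSmoothness_of_isRCLikeNormedField]
  infer_instance

attribute [local instance] lieGroup_minSmoothness finiteDimensional_tangentSpace

/-- The inner product on the Lie algebra of a Lie group given by a metric on the group. -/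
def metricForm (g : Metric E G) : LinearMap.BilinForm ℝ (GroupLieAlgebra 𝓘(ℝ, E) G) :=
  LinearMap.mk₂ ℝ (fun a b => g.inner 1 a b) (fun a a' b => by simp) (fun r a b => by simp)
    (fun a b b' => by simp) (fun r a b => by simp)

theorem isSymm_metricForm (g : Metric E G) : (metricForm g).IsSymm :=
  ⟨g.symm 1⟩

theorem nondegenerate_metricForm (g : Metric E G) : (metricForm g).Nondegenerate := by
  refine (isSymm_metricForm g).isRefl.nondegenerate_iff_separatingLeft.2 fun a ha => ?_
  by_contra hne
  exact (g.pos 1 a hne).ne' (ha a)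

theorem IsLeftInvariant.inner_mulInvariantVectorField {g : Metric E G} (hg : IsLeftInvariant g)
    (a b : GroupLieAlgebra 𝓘(ℝ, E) G) (y : G) :
    g.inner y (mulInvariantVectorField a y) (mulInvariantVectorField b y) = metricForm g a b :=
  (inner_congr_point g (mul_one y) _ _).symm.trans (hg y 1 a b)

variable [FiniteDimensional ℝ E]

theorem mlieBracket_mulInvariantVectorField (a b : GroupLieAlgebra 𝓘(ℝ, E) G) (y : G) :
    mlieBracket 𝓘(ℝ, E) (mulInvariantVectorField a) (mulInvariantVectorField b) y
      = mulInvariantVectorField ⁅a, b⁆ y := by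
  rw [GroupLieAlgebra.bracket_def, mulInvariantVector_mlieBracket]

theorem IsLeviCivita.apply_mulInvariantVectorField {g : Metric E G} (hg : IsLeftInvariant g)
    {D : Connection E G} (hD : IsLeviCivita g D) (a b : GroupLieAlgebra 𝓘(ℝ, E) G) (y : G) :
    D (mulInvariantVectorField b) y (mulInvariantVectorField a y)
      = mulInvariantVectorField
          (leviCivitaProduct (metricForm g) (nondegenerate_metricForm g) a b) y := by
  have hdiff (a : GroupLieAlgebra 𝓘(ℝ, E) G) : MDiffAt (T% (mulInvariantVectorField a)) y :=
    mdifferentiableAt_mulInvariantVectorField a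
  rw [← eq_leviCivitaProduct (nondegenerate_metricForm g) (isSymm_metricForm g)
    (N := fun a b =>
      maurerCartan y (D (mulInvariantVectorField b) y (mulInvariantVectorField a y))),
    mulInvariantVectorField_maurerCartan]
  · intro a b
    rw [← map_sub, hD.sub_eq_mlieBracket (hdiff a) (hdiff b), mlieBracket_mulInvariantVectorField,
      maurerCartan_mulInvariantVectorField]
  · intro a b c
    rw [← hg.inner_mulInvariantVectorField _ _ y, ← hg.inner_mulInvariantVectorField _ _ y,
      mulInvariantVectorField_maurerCartan, mulInvariantVectorField_maurerCartan]
    exact hD.inner_add_inner_eq_zero _ (hdiff b) (hdiff c)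
      fun z => hg.inner_mulInvariantVectorField b c z

theorem IsLeviCivita.curvature_mulInvariantVectorField {g : Metric E G} (hg : IsLeftInvariant g)
    {D : Connection E G} (hD : IsLeviCivita g D) (a b c : GroupLieAlgebra 𝓘(ℝ, E) G) :
    curvature D (mulInvariantVectorField a) (mulInvariantVectorField b)
      (mulInvariantVectorField c) (1 : G)
        = leviCivitaCurvature (metricForm g) (nondegenerate_metricForm g) a b c := by
  have happly (b c : GroupLieAlgebra 𝓘(ℝ, E) G) :
      (fun y => D (mulInvariantVectorField c) y (mulInvariantVectorField b y))
        = mulInvariantVectorField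
            (leviCivitaProduct (metricForm g) (nondegenerate_metricForm g) b c) :=
    funext (hD.apply_mulInvariantVectorField hg b c)
  rw [curvature, happly, happly, mlieBracket_mulInvariantVectorField,
    hD.apply_mulInvariantVectorField hg, hD.apply_mulInvariantVectorField hg,
    hD.apply_mulInvariantVectorField hg]
  simp only [mulInvariantVectorField_one]
  rfl

end LeftInvariantMetric

section Compatibility

variable {E : Type*} [NormedAddCommGroup E] [NormedSpace ℝ E]
  {M : Type*} [TopologicalSpace M] [ChartedSpace E M] [IsManifold 𝓘(ℝ, E) ∞ M]

theorem mdiffAt_inner (g : Metric E M) {Y Z : Π y : M, TangentSpace 𝓘(ℝ, E) y} {x : M}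
    (hY : MDiffAt (T% Y) x) (hZ : MDiffAt (T% Z) x) :
    MDiffAt (fun y => g.inner y (Y y) (Z y)) x := by
  have hbundle : MDifferentiableAt 𝓘(ℝ, E) (𝓘(ℝ, E).prod 𝓘(ℝ))
      (fun m ↦ TotalSpace.mk' ℝ (E := Bundle.Trivial M ℝ) m (g.inner m (Y m) (Z m))) x := by
    apply MDifferentiableAt.clm_bundle_apply₂ (F₁ := E) (F₂ := E)
    · exact g.contMDiff.mdifferentiableAt (by simp)
    · exact hY
    · exact hZ
  exact ((mdifferentiableAt_totalSpace _ _).1 hbundle).2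

/-- The failure of the connection `D` to be compatible with the metric `g` in the direction `v`. It
is tensorial in `Y` and `Z`, so it can be evaluated on left-invariant vector fields. -/
def metricDefect (g : Metric E M) (D : Connection E M) {x : M} (v : TangentSpace 𝓘(ℝ, E) x)
    (Y Z : Π y : M, TangentSpace 𝓘(ℝ, E) y) : ℝ :=
  mvfderiv 𝓘(ℝ, E) (fun y => g.inner y (Y y) (Z y)) x v
    - g.inner x (D Y x v) (Z x) - g.inner x (Y x) (D Z x v)

theorem metricDefect_comm (g : Metric E M) (D : Connection E M) {x : M}
    (v : TangentSpace 𝓘(ℝ, E) x) (Y Z : Π y : M, TangentSpace 𝓘(ℝ, E) y) :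
    metricDefect g D v Y Z = metricDefect g D v Z Y := by
  simp only [metricDefect, g.symm _ (Y _), g.symm _ (D Y _ _)]
  ring

theorem tensorialAt_metricDefect (g : Metric E M) (D : Connection E M) {x : M}
    (v : TangentSpace 𝓘(ℝ, E) x) {Z : Π y : M, TangentSpace 𝓘(ℝ, E) y} (hZ : MDiffAt (T% Z) x) :
    TensorialAt 𝓘(ℝ, E) E (fun Y => metricDefect g D v Y Z) x where
  smul {f σ} hf hσ := by
    have hsmul : (fun y => g.inner y ((f • σ) y) (Z y)) = f * fun y => g.inner y (σ y) (Z y) := by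
      ext y
      change g.inner y (f y • σ y) (Z y) = f y * g.inner y (σ y) (Z y)
      rw [map_smul]
      rfl
    simp only [metricDefect]
    rw [hsmul, mvfderiv_mul hf (mdiffAt_inner g hσ hZ),
      D.isCovariantDerivativeOnUniv.leibniz hσ hf]
    simp only [_root_.add_apply, _root_.smul_apply, smul_eq_mul,
      map_add, map_smul, ContinuousLinearMap.smulRight_apply, Pi.smul_apply']
    ring
  add {σ σ'} hσ hσ' := by
    have hadd : (fun y => g.inner y ((σ + σ') y) (Z y))
        = (fun y => g.inner y (σ y) (Z y)) + fun y => g.inner y (σ' y) (Z y) := by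
      ext y
      simp
    simp only [metricDefect]
    rw [hadd, mvfderiv_add (mdiffAt_inner g hσ hZ) (mdiffAt_inner g hσ' hZ),
      D.isCovariantDerivativeOnUniv.add hσ hσ']
    simp only [_root_.add_apply, map_add, Pi.add_apply]
    ring

theorem metricDefect_congr [FiniteDimensional ℝ E] (g : Metric E M) (D : Connection E M) {x : M}
    (v : TangentSpace 𝓘(ℝ, E) x) {Y Y' Z Z' : Π y : M, TangentSpace 𝓘(ℝ, E) y}
    (hY : MDiffAt (T% Y) x) (hY' : MDiffAt (T% Y') x) (hZ : MDiffAt (T% Z) x)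
    (hZ' : MDiffAt (T% Z') x) (hYY' : Y x = Y' x) (hZZ' : Z x = Z' x) :
    metricDefect g D v Y Z = metricDefect g D v Y' Z' := by
  refine TensorialAt.pointwise₂ (fun τ hτ => tensorialAt_metricDefect g D v hτ)
    (fun σ hσ => ?_) hY hY' hZ hZ' hYY' hZZ'
  simp only [metricDefect_comm g D v σ]
  exact tensorialAt_metricDefect g D v hσ

end Compatibility

section Existence

variable {E : Type*} [NormedAddCommGroup E] [NormedSpace ℝ E] [FiniteDimensional ℝ E]
  {G : Type*} [TopologicalSpace G] [ChartedSpace E G] [Group G] [LieGroup 𝓘(ℝ, E) ∞ G]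
  {g : Metric E G}

attribute [local instance] lieGroup_minSmoothness finiteDimensional_tangentSpace

theorem torsion_invariantConnection
    (N : GroupLieAlgebra 𝓘(ℝ, E) G →ₗ[ℝ] GroupLieAlgebra 𝓘(ℝ, E) G →ₗ[ℝ]
      GroupLieAlgebra 𝓘(ℝ, E) G) (hN : ∀ a b, N a b - N b a = ⁅a, b⁆) :
    (invariantConnection N).torsion = 0 := by
  ext x u v
  rw [← mulInvariantVectorField_maurerCartan x u, ← mulInvariantVectorField_maurerCartan x v,
    CovariantDerivative.torsion_apply _ (mdifferentiableAt_mulInvariantVectorField _)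
      (mdifferentiableAt_mulInvariantVectorField _), invariantConnection_mulInvariantVectorField,
    invariantConnection_mulInvariantVectorField, mlieBracket_mulInvariantVectorField, ← hN,
    ← maurerCartan_symm_apply, ← maurerCartan_symm_apply, ← maurerCartan_symm_apply, map_sub,
    sub_self]
  rfl

theorem metricDefect_invariantConnection (hg : IsLeftInvariant g)
    (N : GroupLieAlgebra 𝓘(ℝ, E) G →ₗ[ℝ] GroupLieAlgebra 𝓘(ℝ, E) G →ₗ[ℝ]
      GroupLieAlgebra 𝓘(ℝ, E) G)
    (hN : ∀ a b c, metricForm g (N a b) c + metricForm g b (N a c) = 0)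
    {x : G} (v : TangentSpace 𝓘(ℝ, E) x) {Y Z : Π y : G, TangentSpace 𝓘(ℝ, E) y}
    (hY : MDiffAt (T% Y) x) (hZ : MDiffAt (T% Z) x) :
    metricDefect g (invariantConnection N) v Y Z = 0 := by
  rw [metricDefect_congr g (invariantConnection N) v hY
    (mdifferentiableAt_mulInvariantVectorField (maurerCartan x (Y x))) hZ
    (mdifferentiableAt_mulInvariantVectorField (maurerCartan x (Z x)))
    (mulInvariantVectorField_maurerCartan x _).symm (mulInvariantVectorField_maurerCartan x _).symm,
    metricDefect, ← mulInvariantVectorField_maurerCartan x v]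
  simp only [invariantConnection_mulInvariantVectorField, hg.inner_mulInvariantVectorField]
  rw [mvfderiv_const, _root_.zero_apply, zero_sub, ← neg_add', hN, neg_zero]

theorem IsLeftInvariant.exists_isLeviCivita (hg : IsLeftInvariant g) :
    ∃ D : Connection E G, IsLeviCivita g D := by
  have hnd := nondegenerate_metricForm g
  refine ⟨invariantConnection (leviCivitaProduct (metricForm g) hnd),
    torsion_invariantConnection _ (leviCivitaProduct_sub_leviCivitaProduct hnd),
    fun x v Y Z hY hZ => ?_⟩
  have hdefect := metricDefect_invariantConnection hg _
    (form_leviCivitaProduct_add_form_leviCivitaProduct hnd (isSymm_metricForm g)) v hY hZ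
  rw [metricDefect] at hdefect
  exact sub_eq_zero.1 ((sub_sub _ _ _).symm.trans hdefect)

theorem IsLeftInvariant.lieSectionalCurvature_eq (hg : IsLeftInvariant g)
    (a b : GroupLieAlgebra 𝓘(ℝ, E) G) :
    lieSectionalCurvature g a b
      = metricForm g (leviCivitaCurvature (metricForm g) (nondegenerate_metricForm g) a b b) a := by
  have hex := hg.exists_isLeviCivita
  rw [lieSectionalCurvature, sectionalCurvature, dif_pos hex,
    hex.choose_spec.curvature_mulInvariantVectorField hg, mulInvariantVectorField_one]
  rfl

end Existence

theorem lieBracket_fderiv_inr_fderiv_inl {E : Type*} [NormedAddCommGroup E] [NormedSpace ℝ E]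
    {F : E × E → E} {e : E} (hF : ContDiffAt ℝ 2 F (e, e)) {a b : E}
    (ha : fderiv ℝ F (e, e) (0, a) = a) (hb : fderiv ℝ F (e, e) (b, 0) = b) :
    lieBracket ℝ (fun u => fderiv ℝ F (u, e) (0, a)) (fun u => fderiv ℝ F (e, u) (b, 0)) e
      = 0 := by
  have hd2 : HasFDerivAt (fderiv ℝ F) (fderiv ℝ (fderiv ℝ F) (e, e)) (e, e) :=
    ((hF.fderiv_right (m := 1) (by norm_num)).differentiableAt (by simp)).hasFDerivAt
  have hV : HasFDerivAt (fun u => fderiv ℝ F (u, e) (0, a)) _ e :=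
    (hd2.comp (f := fun u => (u, e)) e (hasFDerivAt_prodMk_left e e)).clm_apply
      (hasFDerivAt_const (0, a) e)
  have hW : HasFDerivAt (fun u => fderiv ℝ F (e, u) (b, 0)) _ e :=
    (hd2.comp (f := fun u => (e, u)) e (hasFDerivAt_prodMk_right e e)).clm_apply
      (hasFDerivAt_const (b, 0) e)
  rw [lieBracket, ha, hb, hV.fderiv, hW.fderiv]
  simpa using sub_eq_zero.2 (hF.isSymmSndFDerivAt (by simp) (0, a) (b, 0))

section Chart

variable {E : Type*} [NormedAddCommGroup E] [NormedSpace ℝ E]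
  {M : Type*} [TopologicalSpace M] [ChartedSpace E M] [IsManifold 𝓘(ℝ, E) ∞ M]

theorem mpullbackWithin_extChartAt_symm_apply {x : M} {u : E}
    (hu : u ∈ (extChartAt 𝓘(ℝ, E) x).target) (V : Π y : M, TangentSpace 𝓘(ℝ, E) y) :
    mpullbackWithin 𝓘(ℝ, E) 𝓘(ℝ, E) (extChartAt 𝓘(ℝ, E) x).symm V (Set.range 𝓘(ℝ, E)) u
      = mfderiv 𝓘(ℝ, E) 𝓘(ℝ, E) (extChartAt 𝓘(ℝ, E) x) ((extChartAt 𝓘(ℝ, E) x).symm u)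
          (V ((extChartAt 𝓘(ℝ, E) x).symm u)) := by
  rw [mpullbackWithin_apply, ContinuousLinearMap.inverse_eq
    (mfderivWithin_extChartAt_symm_comp_mfderiv_extChartAt hu)
    (mfderiv_extChartAt_comp_mfderivWithin_extChartAt_symm hu)]
  rfl

theorem hasFDerivAt_extChartAt_comp_comp_symm {x y : M} {f : M → M} (hf : MDiffAt f x)
    (hfx : f x = y) (hy : y ∈ (extChartAt 𝓘(ℝ, E) x).source) :
    HasFDerivAt (fun v => extChartAt 𝓘(ℝ, E) x (f ((extChartAt 𝓘(ℝ, E) x).symm v)))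
      (mfderiv 𝓘(ℝ, E) 𝓘(ℝ, E) (extChartAt 𝓘(ℝ, E) x) y ∘L
        mfderiv 𝓘(ℝ, E) 𝓘(ℝ, E) f x : E →L[ℝ] E) (extChartAt 𝓘(ℝ, E) x x) := by
  subst hfx
  have hφ := (mdifferentiableAt_extChartAt (I := 𝓘(ℝ, E))
    (extChartAt_source 𝓘(ℝ, E) x ▸ hy)).hasMFDerivAt
  have hcomp := (hφ.comp x hf.hasMFDerivAt).2
  rw [modelWithCornersSelf_coe, Set.range_id] at hcomp
  exact (hasFDerivWithinAt_univ (E := E) (F := E)).1 hcomp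

theorem mfderiv_extChartAt_apply_of_eq {x y : M} (hyx : y = x)
    (V : Π y : M, TangentSpace 𝓘(ℝ, E) y) :
    (mfderiv 𝓘(ℝ, E) 𝓘(ℝ, E) (extChartAt 𝓘(ℝ, E) x) y (V y) : E) = V x := by
  subst hyx
  rw [mfderiv_extChartAt_self]
  rfl

end Chart

section Bracket

variable {E : Type*} [NormedAddCommGroup E] [NormedSpace ℝ E]
  {G : Type*} [TopologicalSpace G] [ChartedSpace E G] [Group G]

variable (E G) in
/-- The multiplication of a Lie group, read in the preferred chart at the identity. -/
def chartMul (p : E × E) : E :=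
  extChartAt 𝓘(ℝ, E) (1 : G)
    ((extChartAt 𝓘(ℝ, E) (1 : G)).symm p.1 * (extChartAt 𝓘(ℝ, E) (1 : G)).symm p.2)

theorem rightInvariantVectorField_one (a : GroupLieAlgebra 𝓘(ℝ, E) G) :
    rightInvariantVectorField a (1 : G) = a :=
  mfderiv_apply_of_eq_id (E := E) (funext mul_one) 1 a

variable [LieGroup 𝓘(ℝ, E) ∞ G]

theorem mdifferentiableAt_mul_right (y x : G) :
    MDifferentiableAt 𝓘(ℝ, E) 𝓘(ℝ, E) (fun z : G => z * y) x :=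
  (contMDiff_mul_right (n := ∞)).mdifferentiable (by simp) x

theorem contDiffAt_chartMul :
    ContDiffAt ℝ 2 (chartMul E G) (extChartAt 𝓘(ℝ, E) (1 : G) 1, extChartAt 𝓘(ℝ, E) (1 : G) 1) := by
  have hsymm : ContMDiffAt 𝓘(ℝ, E) 𝓘(ℝ, E) 2 (extChartAt 𝓘(ℝ, E) (1 : G)).symm
      (extChartAt 𝓘(ℝ, E) (1 : G) 1) :=
    (contMDiffOn_extChartAt_symm (1 : G)).contMDiffAt (extChartAt_target_mem_nhds (1 : G))
  have hmul := (hsymm.comp (I := 𝓘(ℝ, E × E)) (f := Prod.fst) (_, _) contDiffAt_fst.contMDiffAt).mul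
    (hsymm.comp (f := Prod.snd) (_, _) contDiffAt_snd.contMDiffAt)
  refine (ContMDiffAt.comp (g := extChartAt 𝓘(ℝ, E) (1 : G)) _ ?_ hmul).contDiffAt
  simp only [Pi.mul_apply, Function.comp_apply, extChartAt_to_inv, mul_one]
  exact contMDiffAt_extChartAt

theorem fderiv_chartMul_inr {u : E} (hu : u ∈ (extChartAt 𝓘(ℝ, E) (1 : G)).target)
    (hd : DifferentiableAt ℝ (chartMul E G) (u, extChartAt 𝓘(ℝ, E) (1 : G) 1))
    (a : GroupLieAlgebra 𝓘(ℝ, E) G) :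
    fderiv ℝ (chartMul E G) (u, extChartAt 𝓘(ℝ, E) (1 : G) 1) (0, a)
      = mpullbackWithin 𝓘(ℝ, E) 𝓘(ℝ, E) (extChartAt 𝓘(ℝ, E) (1 : G)).symm
          (mulInvariantVectorField a) (Set.range 𝓘(ℝ, E)) u := by
  have hpartial := hd.hasFDerivAt.comp (extChartAt 𝓘(ℝ, E) (1 : G) 1)
    (hasFDerivAt_prodMk_right u (extChartAt 𝓘(ℝ, E) (1 : G) 1))
  have htranslate := hasFDerivAt_extChartAt_comp_comp_symm (mdifferentiableAt_mul_left (E := E)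
    ((extChartAt 𝓘(ℝ, E) (1 : G)).symm u) 1) (mul_one _)
    ((extChartAt 𝓘(ℝ, E) (1 : G)).map_target hu)
  rw [mpullbackWithin_extChartAt_symm_apply hu]
  exact congrArg (fun L : E →L[ℝ] E => L a) (hpartial.unique htranslate)

theorem fderiv_chartMul_inl {u : E} (hu : u ∈ (extChartAt 𝓘(ℝ, E) (1 : G)).target)
    (hd : DifferentiableAt ℝ (chartMul E G) (extChartAt 𝓘(ℝ, E) (1 : G) 1, u))
    (b : GroupLieAlgebra 𝓘(ℝ, E) G) :
    fderiv ℝ (chartMul E G) (extChartAt 𝓘(ℝ, E) (1 : G) 1, u) (b, 0)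
      = mpullbackWithin 𝓘(ℝ, E) 𝓘(ℝ, E) (extChartAt 𝓘(ℝ, E) (1 : G)).symm
          (rightInvariantVectorField b) (Set.range 𝓘(ℝ, E)) u := by
  have hpartial := hd.hasFDerivAt.comp (f := fun v => (v, u)) (extChartAt 𝓘(ℝ, E) (1 : G) 1)
    (hasFDerivAt_prodMk_left (extChartAt 𝓘(ℝ, E) (1 : G) 1) u)
  have htranslate := hasFDerivAt_extChartAt_comp_comp_symm (mdifferentiableAt_mul_right (E := E)
    ((extChartAt 𝓘(ℝ, E) (1 : G)).symm u) 1) (one_mul _)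
    ((extChartAt 𝓘(ℝ, E) (1 : G)).map_target hu)
  rw [mpullbackWithin_extChartAt_symm_apply hu]
  exact congrArg (fun L : E →L[ℝ] E => L b) (hpartial.unique htranslate)

theorem fderiv_chartMul_inr_self (a : GroupLieAlgebra 𝓘(ℝ, E) G) :
    fderiv ℝ (chartMul E G) (extChartAt 𝓘(ℝ, E) (1 : G) 1, extChartAt 𝓘(ℝ, E) (1 : G) 1) (0, a)
      = a := by
  rw [fderiv_chartMul_inr (mem_extChartAt_target 1)
      (contDiffAt_chartMul.differentiableAt (by simp)),
    mpullbackWithin_extChartAt_symm_apply (mem_extChartAt_target 1)]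
  exact (mfderiv_extChartAt_apply_of_eq (extChartAt_to_inv 1) _).trans
    (mulInvariantVectorField_one a)

theorem fderiv_chartMul_inl_self (b : GroupLieAlgebra 𝓘(ℝ, E) G) :
    fderiv ℝ (chartMul E G) (extChartAt 𝓘(ℝ, E) (1 : G) 1, extChartAt 𝓘(ℝ, E) (1 : G) 1) (b, 0)
      = b := by
  rw [fderiv_chartMul_inl (mem_extChartAt_target 1)
      (contDiffAt_chartMul.differentiableAt (by simp)),
    mpullbackWithin_extChartAt_symm_apply (mem_extChartAt_target 1)]
  exact (mfderiv_extChartAt_apply_of_eq (extChartAt_to_inv 1) _).trans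
    (rightInvariantVectorField_one b)

theorem mlieBracket_mulInvariantVectorField_rightInvariantVectorField
    (a b : GroupLieAlgebra 𝓘(ℝ, E) G) :
    mlieBracket 𝓘(ℝ, E) (mulInvariantVectorField a) (rightInvariantVectorField b) (1 : G) = 0 := by
  have htarget := extChartAt_target_mem_nhds (I := 𝓘(ℝ, E)) (1 : G)
  have hdiff : ∀ᶠ p in 𝓝 (extChartAt 𝓘(ℝ, E) (1 : G) 1, extChartAt 𝓘(ℝ, E) (1 : G) 1),
      DifferentiableAt ℝ (chartMul E G) p :=
    (contDiffAt_chartMul.eventually (by simp)).mono fun _ hp => hp.differentiableAt (by simp)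
  have hL : mpullbackWithin 𝓘(ℝ, E) 𝓘(ℝ, E) (extChartAt 𝓘(ℝ, E) (1 : G)).symm
      (mulInvariantVectorField a) (Set.range 𝓘(ℝ, E)) =ᶠ[𝓝 (extChartAt 𝓘(ℝ, E) (1 : G) 1)]
      fun u => fderiv ℝ (chartMul E G) (u, extChartAt 𝓘(ℝ, E) (1 : G) 1) (0, a) := by
    filter_upwards [htarget, (Continuous.prodMk_left _).continuousAt.eventually hdiff] with u hu hd
    exact (fderiv_chartMul_inr hu hd a).symm
  have hR : mpullbackWithin 𝓘(ℝ, E) 𝓘(ℝ, E) (extChartAt 𝓘(ℝ, E) (1 : G)).symm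
      (rightInvariantVectorField b) (Set.range 𝓘(ℝ, E)) =ᶠ[𝓝 (extChartAt 𝓘(ℝ, E) (1 : G) 1)]
      fun u => fderiv ℝ (chartMul E G) (extChartAt 𝓘(ℝ, E) (1 : G) 1, u) (b, 0) := by
    filter_upwards [htarget, (Continuous.prodMk_right _).continuousAt.eventually hdiff] with u hu hd
    exact (fderiv_chartMul_inl hu hd b).symm
  have hzero := lieBracket_fderiv_inr_fderiv_inl (contDiffAt_chartMul (G := G))
    (fderiv_chartMul_inr_self a) (fderiv_chartMul_inl_self b)
  rw [← lieBracketWithin_univ] at hzero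
  rw [← mlieBracketWithin_univ, mlieBracketWithin_apply, Set.preimage_univ, Set.univ_inter,
    modelWithCornersSelf_coe, Set.range_id]
  rw [modelWithCornersSelf_coe, Set.range_id] at hL hR
  exact (congrArg _ ((hL.lieBracketWithin_vectorField_eq_nhds hR).trans hzero)).trans (map_zero _)

end Bracket

section BiInvariant

variable {E : Type*} [NormedAddCommGroup E] [NormedSpace ℝ E]
  {G : Type*} [TopologicalSpace G] [ChartedSpace E G] [Group G] [LieGroup 𝓘(ℝ, E) ∞ G]
  {g : Metric E G}

theorem IsRightInvariant.inner_rightInvariantVectorField (hg : IsRightInvariant g)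
    (a b : GroupLieAlgebra 𝓘(ℝ, E) G) (y : G) :
    g.inner y (rightInvariantVectorField a y) (rightInvariantVectorField b y)
      = metricForm g a b :=
  (inner_congr_point g (one_mul y) _ _).symm.trans (hg y 1 a b)

variable [FiniteDimensional ℝ E]

attribute [local instance] lieGroup_minSmoothness

theorem IsLeviCivita.lie_eq_sub {D : Connection E G} (hD : IsLeviCivita g D)
    (a b : GroupLieAlgebra 𝓘(ℝ, E) G) :
    ⁅a, b⁆ = D (mulInvariantVectorField b) 1 a - D (rightInvariantVectorField b) 1 a := by
  have hL := hD.sub_eq_mlieBracket (mdifferentiableAt_mulInvariantVectorField (g := 1) a)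
    (mdifferentiableAt_mulInvariantVectorField b)
  have hR := hD.sub_eq_mlieBracket (mdifferentiableAt_mulInvariantVectorField a)
    (mdiffAt_rightInvariantVectorField b 1)
  rw [mlieBracket_mulInvariantVectorField_rightInvariantVectorField] at hR
  rw [mlieBracket_mulInvariantVectorField] at hL
  simp only [mulInvariantVectorField_one, rightInvariantVectorField_one] at hL hR
  rw [← hL, sub_eq_zero.1 hR]

theorem IsBiInvariant.lieInvariant_metricForm (hg : IsBiInvariant g) :
    (metricForm g).lieInvariant (GroupLieAlgebra 𝓘(ℝ, E) G) := by
  obtain ⟨D, hD⟩ := hg.1.exists_isLeviCivita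
  intro a b c
  have hL := hD.inner_add_inner_eq_zero (x := 1) a (mdifferentiableAt_mulInvariantVectorField b)
    (mdifferentiableAt_mulInvariantVectorField c) (hg.1.inner_mulInvariantVectorField b c)
  have hR := hD.inner_add_inner_eq_zero (x := 1) a (mdiffAt_rightInvariantVectorField b 1)
    (mdiffAt_rightInvariantVectorField c 1) (hg.2.inner_rightInvariantVectorField b c)
  rw [mulInvariantVectorField_one, mulInvariantVectorField_one] at hL
  rw [rightInvariantVectorField_one, rightInvariantVectorField_one] at hR
  rw [hD.lie_eq_sub, hD.lie_eq_sub, map_sub, map_sub, LinearMap.sub_apply]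
  change metricForm g _ _ + metricForm g _ _ = 0 at hL hR
  linarith

end BiInvariant

section Family

theorem contDiffAt_quarticRemainder {𝕜 V : Type*} [NontriviallyNormedField 𝕜] [LieRing V]
    [LieAlgebra 𝕜 V] {B : LinearMap.BilinForm 𝕜 V} (Ψ : V →ₗ[𝕜] V) (X Y : V) {Φ : 𝕜 → V →ₗ[𝕜] V}
    {n : ℕ∞ω} (hΦ : ∀ a b, ContDiffAt 𝕜 n (fun t => B (Φ t a) b) 0) :
    ContDiffAt 𝕜 n (fun t => quarticRemainder B Ψ X Y t (Φ t)) 0 := by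
  have hform (v w : V) :
      ContDiffAt 𝕜 n (fun t => B (Φ t (Ψ (Ψ (v - t • w)))) (v - t • w)) 0 := by
    simp only [map_sub, map_smul, LinearMap.sub_apply, LinearMap.smul_apply, smul_eq_mul]
    exact ((hΦ _ _).sub (contDiffAt_id.mul (hΦ _ _))).sub
      (contDiffAt_id.mul ((hΦ _ _).sub (contDiffAt_id.mul (hΦ _ _))))
  exact ContDiffAt.add (by fun_prop) (hform _ _)

variable {E : Type*} [NormedAddCommGroup E] [NormedSpace ℝ E] [FiniteDimensional ℝ E]
  {G : Type*} [TopologicalSpace G] [ChartedSpace E G] [Group G] [LieGroup 𝓘(ℝ, E) ∞ G]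

attribute [local instance] lieGroup_minSmoothness finiteDimensional_tangentSpace

theorem IsLeftInvariant.lieSectionalCurvature_of_symm_eq {g g₀ : Metric E G}
    (hg : IsLeftInvariant g)
    (hg₀ : (metricForm g₀).lieInvariant (GroupLieAlgebra 𝓘(ℝ, E) G))
    {Φ : GroupLieAlgebra 𝓘(ℝ, E) G ≃ₗ[ℝ] GroupLieAlgebra 𝓘(ℝ, E) G}
    (hΦ : ∀ a b, metricForm g a b = metricForm g₀ (Φ a) b)
    {Ψ : GroupLieAlgebra 𝓘(ℝ, E) G →ₗ[ℝ] GroupLieAlgebra 𝓘(ℝ, E) G}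
    (hΨs : ∀ a b, metricForm g₀ (Ψ a) b = metricForm g₀ a (Ψ b)) {t : ℝ}
    (hΨ : ∀ a, Φ.symm a = a - t • Ψ a) {X Y : GroupLieAlgebra 𝓘(ℝ, E) G} (hXY : ⁅X, Y⁆ = 0) :
    lieSectionalCurvature g (Φ.symm X) (Φ.symm Y)
      = t ^ 3 * (cubicCoefficient (metricForm g₀) Ψ X Y
        - 3 / 4 * t * quarticRemainder (metricForm g₀) Ψ X Y t Φ.toLinearMap) := by
  rw [hg.lieSectionalCurvature_eq]
  linear_combination (1 / 4) * four_mul_form_leviCivitaCurvature_of_symm_eq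
    (nondegenerate_metricForm g) (isSymm_metricForm g) hg₀ (isSymm_metricForm g₀) hΦ hΨs hΨ hXY

end Family

end LieGroupCurvature

end

open LieGroupCurvature in
attribute [local instance] lieGroup_minSmoothness in
theorem lemma2_general
    {E : Type*} [NormedAddCommGroup E] [NormedSpace ℝ E] [FiniteDimensional ℝ E]
    {G : Type*} [TopologicalSpace G] [ChartedSpace E G] [Group G] [LieGroup 𝓘(ℝ, E) ∞ G]
    {ε : ℝ} (hε : 0 < ε)
    {h : ℝ → Metric E G}
    (h_left : ∀ t ∈ Set.Ioo (-ε) ε, IsLeftInvariant (h t))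
    (h_ad : ∀ A B C : GroupLieAlgebra 𝓘(ℝ, E) G,
      (h 0).inner 1 ⁅A, B⁆ C = -(h 0).inner 1 B ⁅A, C⁆)
    {Φ : ℝ → (GroupLieAlgebra 𝓘(ℝ, E) G ≃ₗ[ℝ] GroupLieAlgebra 𝓘(ℝ, E) G)}
    (hΦ : ∀ t ∈ Set.Ioo (-ε) ε, ∀ A B : GroupLieAlgebra 𝓘(ℝ, E) G,
      (h t).inner 1 A B = (h 0).inner 1 (Φ t A) B)
    {Ψ : GroupLieAlgebra 𝓘(ℝ, E) G →ₗ[ℝ] GroupLieAlgebra 𝓘(ℝ, E) G}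
    (hΨ : ∀ t ∈ Set.Ioo (-ε) ε, ∀ A : GroupLieAlgebra 𝓘(ℝ, E) G,
      (Φ t).symm A = A - t • Ψ A)
    {X Y : GroupLieAlgebra 𝓘(ℝ, E) G} (hXY : ⁅X, Y⁆ = 0)
    {κ : ℝ → ℝ}
    (hκ : ∀ t ∈ Set.Ioo (-ε) ε,
      κ t = lieSectionalCurvature (h t) ((Φ t).symm X) ((Φ t).symm Y)) :
    ContDiffAt ℝ ω κ 0 ∧ κ 0 = 0 ∧ deriv κ 0 = 0 ∧ iteratedDeriv 2 κ 0 = 0 ∧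
      (1 / 6 : ℝ) * iteratedDeriv 3 κ 0
        = (h 0).inner 1 (⁅X, Ψ Y⁆ + ⁅Ψ X, Y⁆) ⁅Ψ X, Ψ Y⁆
          + (h 0).inner 1 ⁅Ψ X, X⁆ (Ψ ⁅Ψ Y, Y⁆)
          - (h 0).inner 1 ⁅X, Ψ Y⁆ (Ψ ⁅X, Ψ Y⁆)
          - (h 0).inner 1 ⁅X, Ψ Y⁆ (Ψ ⁅Ψ X, Y⁆)
          - (h 0).inner 1 ⁅Ψ X, Y⁆ (Ψ ⁅Ψ X, Y⁆) := by
  let B := metricForm (h 0)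
  have hI : Set.Ioo (-ε) ε ∈ 𝓝 (0 : ℝ) := Ioo_mem_nhds (neg_neg_iff_pos.2 hε) hε
  have hmid : ε / 2 ∈ Set.Ioo (-ε) ε := ⟨by linarith, by linarith⟩
  have hΨs : ∀ a b, B (Ψ a) b = B a (Ψ b) :=
    form_apply_comm_of_symm_eq (Φ := Φ (ε / 2)) (isSymm_metricForm _) (isSymm_metricForm _)
      (hΦ _ hmid) (half_pos hε).ne' (hΨ _ hmid)
  let s (t : ℝ) := cubicCoefficient B Ψ X Y
    - 3 / 4 * t * quarticRemainder B Ψ X Y t (Φ t).toLinearMap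
  have hs (n : ℕ∞ω) : ContDiffAt ℝ n s 0 := by
    have hr := contDiffAt_quarticRemainder Ψ X Y (B := B) fun a b =>
      contDiffAt_form_apply_of_symm_eq (V := E) (eventually_of_mem hI hΨ) (B.flip b) a n
    fun_prop
  have hκs : κ =ᶠ[𝓝 0] fun t => t ^ 3 * s t := by
    filter_upwards [hI] with t ht
    rw [hκ t ht, (h_left t ht).lieSectionalCurvature_of_symm_eq h_ad (hΦ t ht) hΨs (hΨ t ht) hXY]
  have hderiv {k : ℕ} (hk : k ≤ 3) := (hκs.iteratedDeriv_eq k).trans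
    (iteratedDeriv_pow_mul_zero (hs _) hk)
  refine ⟨((contDiff_fun_id.pow 3).contDiffAt.mul (hs ω)).congr_of_eventuallyEq hκs, ?_, ?_,
    hderiv (by norm_num), ?_⟩
  · exact hderiv (k := 0) (by norm_num)
  · rw [← iteratedDeriv_one, hderiv (by norm_num)]
    norm_num
  · refine Eq.trans ?_ (show cubicCoefficient B Ψ X Y = _ from rfl)
    rw [hderiv le_rfl]
    simp [s, Nat.factorial]

theorem lemma2
    {E : Type*} [NormedAddCommGroup E] [NormedSpace ℝ E] [FiniteDimensional ℝ E]
    {G : Type*} [TopologicalSpace G] [ChartedSpace E G] [Group G] [LieGroup 𝓘(ℝ, E) ∞ G]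
    [CompactSpace G]
    (ε : ℝ) (hε : 0 < ε)
    (h : ℝ → LieGroupCurvature.Metric E G)
    (h_left : ∀ t ∈ Set.Ioo (-ε) ε, LieGroupCurvature.IsLeftInvariant (h t))
    (h_bi : LieGroupCurvature.IsBiInvariant (h 0))
    (Φ : ℝ → (GroupLieAlgebra 𝓘(ℝ, E) G ≃ₗ[ℝ] GroupLieAlgebra 𝓘(ℝ, E) G))
    (hΦ : ∀ t ∈ Set.Ioo (-ε) ε, ∀ A B : GroupLieAlgebra 𝓘(ℝ, E) G,
      (h t).inner 1 A B = (h 0).inner 1 (Φ t A) B)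
    (Ψ : GroupLieAlgebra 𝓘(ℝ, E) G →ₗ[ℝ] GroupLieAlgebra 𝓘(ℝ, E) G)
    (hΨ : ∀ t ∈ Set.Ioo (-ε) ε, ∀ A : GroupLieAlgebra 𝓘(ℝ, E) G,
      (Φ t).symm A = A - t • Ψ A)
    (X Y : GroupLieAlgebra 𝓘(ℝ, E) G) (hXY : ⁅X, Y⁆ = 0)
    (κ : ℝ → ℝ)
    (hκ : ∀ t ∈ Set.Ioo (-ε) ε,
      κ t = LieGroupCurvature.lieSectionalCurvature (h t) ((Φ t).symm X) ((Φ t).symm Y)) :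
    ContDiffAt ℝ 3 κ 0 ∧ κ 0 = 0 ∧ deriv κ 0 = 0 ∧ iteratedDeriv 2 κ 0 = 0 ∧
      (1 / 6 : ℝ) * iteratedDeriv 3 κ 0
        = (h 0).inner 1 (⁅X, Ψ Y⁆ + ⁅Ψ X, Y⁆) ⁅Ψ X, Ψ Y⁆
          + (h 0).inner 1 ⁅Ψ X, X⁆ (Ψ ⁅Ψ Y, Y⁆)
          - (h 0).inner 1 ⁅X, Ψ Y⁆ (Ψ ⁅X, Ψ Y⁆)
          - (h 0).inner 1 ⁅X, Ψ Y⁆ (Ψ ⁅Ψ X, Y⁆)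
          - (h 0).inner 1 ⁅Ψ X, Y⁆ (Ψ ⁅Ψ X, Y⁆) :=
  (lemma2_general hε h_left h_bi.lieInvariant_metricForm hΦ hΨ hXY hκ).imp_left fun hsmooth =>
    hsmooth.of_le le_top
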